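/- Let $1\le p\le 2$ and let $\mathcal X$ be a real separable Banach space. Recall that $\mathcal X$ is of Rademacher type $p$ if there is a constant $C<\infty$ such that $$E\Big\|\sum_{i=1}^n\varepsilon_i x_i\Big\|^p\le C\sum_{i=1}^n\|x_i\|^p$$ for all $n$ and all $x_1,\dots,x_n\in\mathcal X$, where $\varepsilon_1,\dots,\varepsilon_n$ are independent with $P(\varepsilon_i=1)=P(\varepsilon_i=-1)=\tfrac12$. A random element of $\mathcal X$ is a Borel measurable $\mathcal X$-valued map on a probability space, and it has mean $0$ if $f(V)$ is integrable with $E f(V)=0$ for every continuous linear functional $f$ on $\mathcal X$. For a double array $\{V_{mn},\,m\ge1,\,n\ge1\}$ of random elements write $S_{mn}=\sum_{i=1}^m\sum_{j=1}^n V_{ij}$. Then the following two statements are equivalent: (i) $\mathcal X$ is of Rademacher type $p$. (ii) For every double array $\{V_{mn},\,m\ge1,\,n\ge1\}$ of independent mean $0$ random elements in $\mathcal X$ (on any probability space), the condition $$\sum_{m=1}^\infty\sum_{n=1}^\infty\frac{E\|V_{mn}\|^p}{m^pn^p}<\infty$$ implies that $S_{mn}/(mn)^{(p+1)/p}$ converges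 completely to $0$ in mean of order $p$, that is, $$\sum_{m=1}^\infty\sum_{n=1}^\infty E\left\|\frac{S_{mn}}{(mn)^{(p+1)/p}}\right\|^p<\infty.$$ -/

import Mathlib

open MeasureTheory ProbabilityTheory
open scoped ENNReal

universe u v

noncomputable section

/-- A real normed space is of Rademacher type `p` if there is a constant `C` such that
`E ‖∑ ε_i x_i‖ ^ p ≤ C ∑ ‖x_i‖ ^ p` for every finite family of vectors `x_i`, where the `ε_i` are
independent random signs. The expectation over the signs is the average over all `2 ^ n` choices
of signs in `ℤˣ = {1, -1}`. -/
def IsRademacherType (p : ℝ) (X : Type u) [NormedAddCommGroup X] [NormedSpace ℝ X] : Prop :=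
  ∃ C : ℝ, ∀ (n : ℕ) (x : Fin n → X),
    (∑ ε : Fin n → ℤˣ, ‖∑ i, ((ε i : ℤ) : ℝ) • x i‖ ^ p) / 2 ^ n ≤ C * ∑ i, ‖x i‖ ^ p

/-- The random element `V` has mean (expected value, in the sense of Pettis) `a`: for each
continuous linear functional `f`, the real random variable `f(V)` is integrable with
expectation `f(a)`. -/
def HasPettisMean {Ω : Type v} [MeasurableSpace Ω] {X : Type u} [NormedAddCommGroup X]
    [NormedSpace ℝ X] (V : Ω → X) (P : Measure Ω) (a : X) : Prop :=
  ∀ f : X →L[ℝ] ℝ, Integrable (fun ω => f (V ω)) P ∧ ∫ ω, f (V ω) ∂P = f a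

/-- `V` is a double array of independent mean-zero random elements of `X`. Here and below the
entry `V m n` stands for the entry with (one-based) indices `(m + 1, n + 1)`. -/
structure IsIndepMeanZeroArray {Ω : Type v} [MeasurableSpace Ω] {X : Type u}
    [NormedAddCommGroup X] [NormedSpace ℝ X] [MeasurableSpace X]
    (V : ℕ → ℕ → Ω → X) (P : Measure Ω) : Prop where
  measurable : ∀ m n, Measurable (V m n)
  indep : iIndepFun (fun k : ℕ × ℕ => V k.1 k.2) P
  mean_zero : ∀ m n, HasPettisMean (V m n) P 0

/-- The double partial sums: with one-based indices, `S_{m+1,n+1}` is the sum of the `V_{ij}`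
over `1 ≤ i ≤ m + 1` and `1 ≤ j ≤ n + 1`. -/
def doubleSum {Ω : Type v} {X : Type u} [NormedAddCommGroup X]
    (V : ℕ → ℕ → Ω → X) (m n : ℕ) (ω : Ω) : X :=
  ∑ i ∈ Finset.range (m + 1), ∑ j ∈ Finset.range (n + 1), V i j ω

/-- The double array `T` converges completely to `0` in mean of order `p`:
`∑_m ∑_n E ‖T_{mn}‖ ^ p < ∞`. -/
def ConvergesCompletelyInMean {Ω : Type v} [MeasurableSpace Ω] {X : Type u}
    [NormedAddCommGroup X] (p : ℝ) (T : ℕ → ℕ → Ω → X) (P : Measure Ω) : Prop :=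
  ∑' m, ∑' n, ∫⁻ ω, ‖T m n ω‖ₑ ^ p ∂P < ∞

end

/-! Type `p` implies convergence: by Jensen, enlarging a sum of independent centred elements cannot
lower its `p`-th moment, so fixed signs can be inserted at the cost of `2 ^ p`. Averaging over signs
and applying the type inequality pointwise yields `E ‖∑ V‖ ^ p ≤ K ∑ E ‖V‖ ^ p`
(`IsRademacherType.exists_lintegral_enorm_sum_rpow_le`). Exchanging sums, the tail of `m ^ (-(p +
1))` from `i` on is of order `i ^ (-p)`, which is the weight in the hypothesis
(`tsum_weighted_double_sum_le`).

Conversely, if type `p` fails, then for each `k` some finite family violates the inequality with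
constant `4 ^ k`. Row `k` carries this family with random signs, in a block of columns comparable to
its length and with total mass scaled to contribute at most `2 ^ (-k)` to the hypothesis. By
monotonicity every rectangle containing the block inherits its moment, and the lower tail bound
makes the concluding series at least a constant times `2 ^ k` for every `k`. -/

/-! ### Moments of sums of independent centred random elements -/

section Moments

variable {X : Type u} [NormedAddCommGroup X] {Ω : Type v} [MeasurableSpace Ω]
  {P : Measure Ω} {p : ℝ}

theorem integrable_of_lintegral_enorm_rpow_lt_top [IsProbabilityMeasure P] (hp : 1 ≤ p)
    {f : Ω → X} (hf : AEStronglyMeasurable f P) (h : ∫⁻ ω, ‖f ω‖ₑ ^ p ∂P < ∞) :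
    Integrable f P := by
  have hp0 : 0 < p := by linarith
  refine ⟨hf, ?_⟩
  have h1 := eLpNorm'_le_eLpNorm'_of_exponent_le one_pos hp P hf
  rw [lintegral_rpow_enorm_eq_rpow_eLpNorm' hp0] at h
  have h2 : eLpNorm' f p P < ∞ := (ENNReal.rpow_lt_top_iff_of_pos hp0).1 h
  simpa [eLpNorm', HasFiniteIntegral] using h1.trans_lt h2

variable [NormedSpace ℝ X]

/-- Jensen's inequality, through monotonicity of `L^p` norms on a probability space. -/
theorem enorm_integral_rpow_le_lintegral [IsProbabilityMeasure P] (hp : 1 ≤ p) {f : Ω → X}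
    (hf : AEStronglyMeasurable f P) :
    ‖∫ ω, f ω ∂P‖ₑ ^ p ≤ ∫⁻ ω, ‖f ω‖ₑ ^ p ∂P := by
  have hp0 : 0 < p := by linarith
  rw [lintegral_rpow_enorm_eq_rpow_eLpNorm' hp0]
  refine ENNReal.rpow_le_rpow ((enorm_integral_le_lintegral_enorm f).trans ?_) hp0.le
  have h := eLpNorm'_le_eLpNorm'_of_exponent_le one_pos hp P hf
  simpa [eLpNorm'] using h

theorem HasPettisMean.integral_eq [CompleteSpace X] {f : Ω → X} {a : X}
    (h : HasPettisMean f P a) (hf : Integrable f P) : ∫ ω, f ω ∂P = a := by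
  refine sub_eq_zero.1 (SeparatingDual.eq_zero_of_forall_dual_eq_zero (R := ℝ) fun g => ?_)
  rw [map_sub, ← g.integral_comp_comm hf, (h g).2, sub_self]

variable [TopologicalSpace.SeparableSpace X] [MeasurableSpace X] [BorelSpace X]

/-- Adding an independent centred random element does not decrease the `p`-th moment. -/
theorem ProbabilityTheory.IndepFun.lintegral_enorm_rpow_le_add [CompleteSpace X]
    [IsProbabilityMeasure P]
    (hp : 1 ≤ p) {U W : Ω → X} (hU : Measurable U) (hW : Measurable W) (hUW : IndepFun U W P)
    (hi : Integrable W P) (h0 : ∫ ω, W ω ∂P = 0) :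
    ∫⁻ ω, ‖U ω‖ₑ ^ p ∂P ≤ ∫⁻ ω, ‖U ω + W ω‖ₑ ^ p ∂P := by
  have : SecondCountableTopology X := UniformSpace.secondCountable_of_separable X
  have : IsProbabilityMeasure (P.map W) := Measure.isProbabilityMeasure_map hW.aemeasurable
  have : IsProbabilityMeasure (P.map U) := Measure.isProbabilityMeasure_map hU.aemeasurable
  have hmap := (indepFun_iff_map_prod_eq_prod_map_map hU.aemeasurable hW.aemeasurable).1 hUW
  have hm : Measurable fun z : X × X => ‖z.1 + z.2‖ₑ ^ p := by fun_prop
  have e : ∫⁻ ω, ‖U ω + W ω‖ₑ ^ p ∂P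
      = ∫⁻ u, ∫⁻ w, ‖u + w‖ₑ ^ p ∂(P.map W) ∂(P.map U) := by
    rw [← lintegral_prod _ hm.aemeasurable, ← hmap, lintegral_map hm (hU.prodMk hW)]
  have hm' : Measurable fun x : X => ‖x‖ₑ ^ p := by fun_prop
  rw [e, ← lintegral_map hm' hU]
  -- Freeze `U = u`: since `W` is centred, `u` is the mean of `u + W`, and Jensen applies.
  refine lintegral_mono fun u => ?_
  have hi' : Integrable (fun w : X => w) (P.map W) :=
    (integrable_map_measure (by fun_prop) hW.aemeasurable).2 hi
  have h0' : ∫ w, w ∂(P.map W) = 0 := by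
    rw [integral_map hW.aemeasurable (by fun_prop)]; exact h0
  have key : ∫ w, (u + w) ∂(P.map W) = u := by
    rw [integral_add (integrable_const u) hi', h0']; simp
  calc ‖u‖ₑ ^ p = ‖∫ w, (u + w) ∂(P.map W)‖ₑ ^ p := by rw [key]
    _ ≤ _ := enorm_integral_rpow_le_lintegral hp (by fun_prop)

variable {ι : Type*} {V : ι → Ω → X}

/-- The `p`-th moments of finite sums of independent centred random elements are monotone in the
index set. -/
theorem ProbabilityTheory.iIndepFun.lintegral_enorm_sum_rpow_mono [CompleteSpace X]
    [IsProbabilityMeasure P]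
    (hp : 1 ≤ p) (hV : ∀ i, Measurable (V i)) (hind : iIndepFun V P)
    (hi : ∀ i, Integrable (V i) P) (h0 : ∀ i, ∫ ω, V i ω ∂P = 0) {A B : Finset ι} (hAB : A ⊆ B) :
    ∫⁻ ω, ‖∑ i ∈ A, V i ω‖ₑ ^ p ∂P ≤ ∫⁻ ω, ‖∑ i ∈ B, V i ω‖ₑ ^ p ∂P := by
  classical
  have : SecondCountableTopology X := UniformSpace.secondCountable_of_separable X
  have hm (s : Finset ι) : Measurable fun x : s → X => ∑ i, x i := by fun_prop
  have hsum (s : Finset ι) (ω : Ω) : ∑ i : s, V i ω = ∑ i ∈ s, V i ω :=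
    Finset.sum_coe_sort s fun i => V i ω
  have hI : IndepFun (fun ω => ∑ i ∈ A, V i ω) (fun ω => ∑ i ∈ B \ A, V i ω) P := by
    simpa only [Function.comp_def, hsum] using
      (hind.indepFun_finset A (B \ A) Finset.disjoint_sdiff hV).comp (hm A) (hm (B \ A))
  have h := hI.lintegral_enorm_rpow_le_add hp (by fun_prop) (by fun_prop)
    (integrable_finsetSum _ fun i _ => hi i)
    (by rw [integral_finsetSum _ fun i _ => hi i]; simp [h0])
  refine h.trans_eq (lintegral_congr fun ω => ?_)
  rw [add_comm, Finset.sum_sdiff hAB]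

/-- Inserting fixed signs into a sum of independent centred random elements decreases its `p`-th
moment by at most the factor `2 ^ p`. -/
theorem ProbabilityTheory.iIndepFun.lintegral_enorm_sum_rpow_le_signs [CompleteSpace X]
    [IsProbabilityMeasure P] [Fintype ι]
    (hp : 1 ≤ p) (hV : ∀ i, Measurable (V i)) (hind : iIndepFun V P)
    (hi : ∀ i, Integrable (V i) P) (h0 : ∀ i, ∫ ω, V i ω ∂P = 0) (ε : ι → ℤˣ) :
    ∫⁻ ω, ‖∑ i, V i ω‖ₑ ^ p ∂P
      ≤ 2 ^ p * ∫⁻ ω, ‖∑ i, ((ε i : ℤ) : ℝ) • V i ω‖ₑ ^ p ∂P := by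
  classical
  have : SecondCountableTopology X := UniformSpace.secondCountable_of_separable X
  set W : ι → Ω → X := fun i ω => ((ε i : ℤ) : ℝ) • V i ω with hW
  have hWm : ∀ i, Measurable (W i) := fun i => (hV i).const_smul _
  have hWind : iIndepFun W P :=
    hind.comp (fun i x => ((ε i : ℤ) : ℝ) • x) fun i => measurable_const_smul _
  have hWi : ∀ i, Integrable (W i) P := fun i => (hi i).smul _
  have hW0 : ∀ i, ∫ ω, W i ω ∂P = 0 := fun i => by
    simp only [hW]; rw [integral_smul, h0, smul_zero]
  have hmono (A : Finset ι) := hWind.lintegral_enorm_sum_rpow_mono hp hWm hWi hW0 A.subset_univ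
  -- The unsigned sum is a difference of two partial sums of the signed family `W`, each dominated
  -- by the full signed sum. Convexity gives `2 ^ (p - 1)`, and the two pieces give the last factor
  -- 2.
  set A : Finset ι := Finset.univ.filter fun i => ε i = 1 with hA
  have hsplit (ω : Ω) : ∑ i, V i ω = ∑ i ∈ A, W i ω - ∑ i ∈ Aᶜ, W i ω := by
    rw [← Finset.sum_add_sum_compl A fun i => V i ω, sub_eq_add_neg, ← Finset.sum_neg_distrib]
    congr 1
    · refine Finset.sum_congr rfl fun i hiA => ?_
      have : ε i = 1 := by simpa [hA] using hiA
      simp [hW, this]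
    · refine Finset.sum_congr rfl fun i hiA => ?_
      have : ε i = -1 := (Int.units_eq_one_or (ε i)).resolve_left (by simpa [hA] using hiA)
      simp [hW, this]
  have hmeas (s : Finset ι) : Measurable fun ω => ‖∑ i ∈ s, W i ω‖ₑ ^ p := by fun_prop
  calc ∫⁻ ω, ‖∑ i, V i ω‖ₑ ^ p ∂P
      ≤ ∫⁻ ω, 2 ^ (p - 1) * (‖∑ i ∈ A, W i ω‖ₑ ^ p + ‖∑ i ∈ Aᶜ, W i ω‖ₑ ^ p) ∂P := by
        refine lintegral_mono fun ω => ?_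
        rw [hsplit]
        exact (ENNReal.rpow_le_rpow enorm_sub_le (by linarith)).trans
          (ENNReal.rpow_add_le_mul_rpow_add_rpow _ _ hp)
    _ = 2 ^ (p - 1) * (∫⁻ ω, ‖∑ i ∈ A, W i ω‖ₑ ^ p ∂P + ∫⁻ ω, ‖∑ i ∈ Aᶜ, W i ω‖ₑ ^ p ∂P) := by
        rw [lintegral_const_mul _ (by fun_prop), lintegral_add_left (hmeas A)]
    _ ≤ 2 ^ (p - 1) * (∫⁻ ω, ‖∑ i, W i ω‖ₑ ^ p ∂P + ∫⁻ ω, ‖∑ i, W i ω‖ₑ ^ p ∂P) :=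
        mul_le_mul_right (add_le_add (hmono A) (hmono Aᶜ)) _
    _ = 2 ^ p * ∫⁻ ω, ‖∑ i, W i ω‖ₑ ^ p ∂P := by
        rw [← two_mul, ← mul_assoc]
        congr 1
        conv_rhs => rw [show p = (p - 1) + 1 by ring,
          ENNReal.rpow_add _ _ two_ne_zero ENNReal.ofNat_ne_top, ENNReal.rpow_one]

end Moments

/-! ### The type inequality for random elements -/

theorem enorm_rpow_eq_ofReal {X : Type u} [NormedAddCommGroup X] {p : ℝ} (hp : 0 ≤ p) (x : X) :
    ‖x‖ₑ ^ p = ENNReal.ofReal (‖x‖ ^ p) := by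
  rw [← ofReal_norm, ENNReal.ofReal_rpow_of_nonneg (norm_nonneg x) hp]

theorem IsRademacherType.exists_sum_enorm_rpow_le {p : ℝ} {X : Type u} [NormedAddCommGroup X]
    [NormedSpace ℝ X] (hp : 0 ≤ p) (h : IsRademacherType p X) :
    ∃ K : ℝ≥0∞, K ≠ ∞ ∧ ∀ (n : ℕ) (x : Fin n → X),
      ∑ ε : Fin n → ℤˣ, ‖∑ i, ((ε i : ℤ) : ℝ) • x i‖ₑ ^ p ≤ 2 ^ n * (K * ∑ i, ‖x i‖ₑ ^ p) := by
  obtain ⟨C, hC⟩ := h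
  refine ⟨ENNReal.ofReal C, ENNReal.ofReal_ne_top, fun n x => ?_⟩
  simp only [enorm_rpow_eq_ofReal hp]
  rw [← ENNReal.ofReal_sum_of_nonneg fun _ _ => by positivity,
    ← ENNReal.ofReal_sum_of_nonneg fun _ _ => by positivity,
    ← ENNReal.ofReal_mul' (by positivity), show (2 : ℝ≥0∞) ^ n = ENNReal.ofReal (2 ^ n) by
      rw [ENNReal.ofReal_pow two_pos.le]; simp, ← ENNReal.ofReal_mul (by positivity)]
  refine ENNReal.ofReal_le_ofReal ?_
  rw [mul_comm (2 ^ n : ℝ)]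
  exact (div_le_iff₀ (by positivity)).1 (hC n x)

/-- In a space of type `p`, the `p`-th moment of a sum of independent centred random elements is
controlled by the sum of the `p`-th moments. -/
theorem IsRademacherType.exists_lintegral_enorm_sum_rpow_le {p : ℝ} (hp : 1 ≤ p) {X : Type u}
    [NormedAddCommGroup X] [NormedSpace ℝ X] [CompleteSpace X] [TopologicalSpace.SeparableSpace X]
    [MeasurableSpace X] [BorelSpace X] (h : IsRademacherType p X) :
    ∃ K : ℝ≥0∞, K ≠ ∞ ∧ ∀ (Ω : Type v) [MeasurableSpace Ω] (P : Measure Ω) [IsProbabilityMeasure P]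
      (ι : Type) (V : ι → Ω → X), (∀ i, Measurable (V i)) → iIndepFun V P →
      (∀ i, Integrable (V i) P) → (∀ i, ∫ ω, V i ω ∂P = 0) → ∀ s : Finset ι,
      ∫⁻ ω, ‖∑ i ∈ s, V i ω‖ₑ ^ p ∂P ≤ K * ∑ i ∈ s, ∫⁻ ω, ‖V i ω‖ₑ ^ p ∂P := by
  have : SecondCountableTopology X := UniformSpace.secondCountable_of_separable X
  obtain ⟨K, hK, hKx⟩ := h.exists_sum_enorm_rpow_le (by linarith)
  refine ⟨2 ^ p * K, ENNReal.mul_ne_top (by simp) hK, ?_⟩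
  intro Ω _ P _ ι V hV hind hi h0 s
  obtain ⟨n, g, rfl⟩ : ∃ (n : ℕ) (g : Fin n ↪ ι), s = Finset.univ.map g := by
    refine ⟨s.card, s.equivFin.symm.toEmbedding.trans (Function.Embedding.subtype _), ?_⟩
    ext i
    simp only [Finset.mem_map, Finset.mem_univ, true_and]
    exact ⟨fun hi => ⟨s.equivFin ⟨i, hi⟩, by simp⟩, fun ⟨j, hj⟩ => hj ▸ (s.equivFin.symm j).2⟩
  simp only [Finset.sum_map]
  have hsign := (hind.precomp g.injective).lintegral_enorm_sum_rpow_le_signs hp (fun i => hV (g i))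
    (fun i => hi (g i)) fun i => h0 (g i)
  have h2 : (2 : ℝ≥0∞) ^ n ≠ 0 := by simp
  have h2' : (2 : ℝ≥0∞) ^ n ≠ ∞ := by simp
  have hcard : Fintype.card (Fin n → ℤˣ) = 2 ^ n := by simp
  -- Multiplying by the number of sign patterns turns the average over signs into a sum.
  rw [← ENNReal.mul_le_mul_iff_right h2 h2']
  calc (2 : ℝ≥0∞) ^ n * ∫⁻ ω, ‖∑ i, V (g i) ω‖ₑ ^ p ∂P
      = ∑ _ε : Fin n → ℤˣ, ∫⁻ ω, ‖∑ i, V (g i) ω‖ₑ ^ p ∂P := by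
        rw [Finset.sum_const, Finset.card_univ, hcard, nsmul_eq_mul]; simp
    _ ≤ ∑ ε : Fin n → ℤˣ, 2 ^ p * ∫⁻ ω, ‖∑ i, ((ε i : ℤ) : ℝ) • V (g i) ω‖ₑ ^ p ∂P :=
        Finset.sum_le_sum fun ε _ => hsign ε
    _ = 2 ^ p * ∫⁻ ω, ∑ ε : Fin n → ℤˣ, ‖∑ i, ((ε i : ℤ) : ℝ) • V (g i) ω‖ₑ ^ p ∂P := by
        rw [← Finset.mul_sum, lintegral_finsetSum _ fun ε _ => by fun_prop]
    _ ≤ 2 ^ p * ∫⁻ ω, 2 ^ n * (K * ∑ i, ‖V (g i) ω‖ₑ ^ p) ∂P := by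
        gcongr with ω
        exact hKx n fun i => V (g i) ω
    _ = 2 ^ n * (2 ^ p * K * ∑ i, ∫⁻ ω, ‖V (g i) ω‖ₑ ^ p ∂P) := by
        rw [lintegral_const_mul _ (by fun_prop), lintegral_const_mul _ (by fun_prop),
          lintegral_finsetSum _ fun i _ => by fun_prop]
        ring

/-! ### Tails of the weights and summation over rectangles -/

section Tails

theorem ofReal_natCast_add_one_rpow {p : ℝ} (hp : 0 ≤ p) (m : ℕ) :
    ENNReal.ofReal (((m : ℝ) + 1) ^ p) = ((m : ℝ≥0∞) + 1) ^ p := by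
  rw [← ENNReal.ofReal_rpow_of_nonneg (by positivity) hp, ENNReal.ofReal_add (by positivity)
    one_pos.le]
  simp

theorem ofReal_inv_natCast_add_one_rpow {p : ℝ} (hp : 0 ≤ p) (m : ℕ) :
    ENNReal.ofReal ((((m : ℝ) + 1) ^ p)⁻¹) = (((m : ℝ≥0∞) + 1) ^ p)⁻¹ := by
  rw [ENNReal.ofReal_inv_of_pos (by positivity), ofReal_natCast_add_one_rpow hp]

/-- Split off `(m + 1) ^ (p - 1) ≥ (N + 1) ^ (p - 1)`, which needs `p ≥ 1`; the remaining inverse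
squares have tail at most `2 / (N + 1)`. -/
theorem sum_range_inv_rpow_tail_le {p : ℝ} (hp : 1 ≤ p) (N n : ℕ) :
    ∑ m ∈ Finset.range n, (if N ≤ m then (((m : ℝ) + 1) ^ (p + 1))⁻¹ else 0)
      ≤ 2 * (((N : ℝ) + 1) ^ p)⁻¹ := by
  have hN : (0 : ℝ) < (N : ℝ) + 1 := by positivity
  have h1 : ∀ m ∈ (Finset.range n).filter (N ≤ ·), (((m : ℝ) + 1) ^ (p + 1))⁻¹
      ≤ (((N : ℝ) + 1) ^ (p - 1))⁻¹ * (((m + 1 : ℕ) : ℝ) ^ 2)⁻¹ := by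
    intro m hm
    have hm' : (N : ℝ) ≤ m := by exact_mod_cast (Finset.mem_filter.1 hm).2
    have hm0 : (0 : ℝ) < (m : ℝ) + 1 := by positivity
    rw [← mul_inv]
    refine inv_anti₀ (by positivity) ?_
    rw [show p + 1 = (p - 1) + 2 by ring, Real.rpow_add hm0]
    push_cast
    rw [Real.rpow_two]
    gcongr
  have h2 : ∑ m ∈ (Finset.range n).filter (N ≤ ·), (((m + 1 : ℕ) : ℝ) ^ 2)⁻¹ ≤ 2 / (N + 1) := by
    refine le_trans (le_of_eq ?_) (sum_Ioo_inv_sq_le N (n + 1))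
    refine Finset.sum_bij' (fun m _ => m + 1) (fun i _ => i - 1) ?_ ?_ ?_ ?_ ?_ <;>
      simp +contextual only [Finset.mem_filter, Finset.mem_range, Finset.mem_Ioo] <;> intros <;>
      first | omega | trivial
  rw [← Finset.sum_filter]
  calc _ ≤ _ := Finset.sum_le_sum h1
    _ ≤ (((N : ℝ) + 1) ^ (p - 1))⁻¹ * (2 / (N + 1)) := by
      rw [← Finset.mul_sum]; gcongr
    _ = 2 * (((N : ℝ) + 1) ^ p)⁻¹ := by
      rw [Real.rpow_sub_one hN.ne']
      field_simp

theorem tsum_inv_rpow_tail_le {p : ℝ} (hp : 1 ≤ p) (N : ℕ) :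
    ∑' m : ℕ, (if N ≤ m then (((m : ℝ≥0∞) + 1) ^ (p + 1))⁻¹ else 0)
      ≤ 2 * (((N : ℝ≥0∞) + 1) ^ p)⁻¹ := by
  refine ENNReal.tsum_le_of_sum_range_le fun n => ?_
  have h := ENNReal.ofReal_le_ofReal (sum_range_inv_rpow_tail_le hp N n)
  rw [ENNReal.ofReal_sum_of_nonneg fun _ _ => by split_ifs <;> positivity,
    ENNReal.ofReal_mul two_pos.le, ofReal_inv_natCast_add_one_rpow (by linarith)] at h
  refine le_trans (le_of_eq (Finset.sum_congr rfl fun m _ => ?_)) (h.trans_eq (by simp))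
  split_ifs
  · rw [ofReal_inv_natCast_add_one_rpow (by linarith)]
  · simp

/-- Keep only the `N + 1` terms with `N ≤ m ≤ 2 * N`, where `m + 1 ≤ 2 * (N + 1)`. -/
theorem le_tsum_inv_rpow_tail {p : ℝ} (hp : 0 ≤ p) (N : ℕ) :
    ((2 : ℝ≥0∞) ^ (p + 1))⁻¹ * (((N : ℝ≥0∞) + 1) ^ p)⁻¹
      ≤ ∑' m : ℕ, (if N ≤ m then (((m : ℝ≥0∞) + 1) ^ (p + 1))⁻¹ else 0) := by
  refine le_trans ?_ (ENNReal.sum_le_tsum (Finset.Ico N (2 * N + 1)))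
  have hN0 : (N : ℝ≥0∞) + 1 ≠ 0 := by simp
  have hNt : (N : ℝ≥0∞) + 1 ≠ ∞ := by simp
  have h : ∀ m ∈ Finset.Ico N (2 * N + 1), ((2 * ((N : ℝ≥0∞) + 1)) ^ (p + 1))⁻¹
      ≤ if N ≤ m then (((m : ℝ≥0∞) + 1) ^ (p + 1))⁻¹ else 0 := by
    intro m hm
    rw [Finset.mem_Ico] at hm
    rw [if_pos hm.1]
    refine ENNReal.inv_le_inv.2 (ENNReal.rpow_le_rpow ?_ (by linarith))
    exact_mod_cast (by omega : m + 1 ≤ 2 * (N + 1))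
  refine le_trans (le_of_eq ?_) (Finset.card_nsmul_le_sum _ _ _ h)
  rw [Nat.card_Ico, show 2 * N + 1 - N = N + 1 by omega, nsmul_eq_mul,
    ENNReal.mul_rpow_of_nonneg _ _ (by linarith), ENNReal.mul_inv (by simp) (by simp),
    ENNReal.rpow_add _ _ hN0 hNt, ENNReal.rpow_one, ENNReal.mul_inv (by simp) (by simp)]
  push_cast
  rw [mul_left_comm, mul_comm _ ((N : ℝ≥0∞) + 1)⁻¹, ← mul_assoc ((N : ℝ≥0∞) + 1),
    ENNReal.mul_inv_cancel hN0 hNt, one_mul]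

theorem ENNReal.tsum_mul_sum_range_succ (w f : ℕ → ℝ≥0∞) :
    ∑' m, w m * ∑ i ∈ Finset.range (m + 1), f i
      = ∑' i, f i * ∑' m, if i ≤ m then w m else 0 := by
  have h (m : ℕ) : ∑ i ∈ Finset.range (m + 1), f i = ∑' i, if i ≤ m then f i else 0 := by
    rw [tsum_eq_sum (s := Finset.range (m + 1)) fun i hi => by
      simp only [Finset.mem_range] at hi; rw [if_neg (by omega)]]
    exact Finset.sum_congr rfl fun i hi => by
      simp only [Finset.mem_range] at hi; rw [if_pos (by omega)]
  simp only [h, ← ENNReal.tsum_mul_left]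
  rw [ENNReal.tsum_comm]
  refine tsum_congr fun i => tsum_congr fun m => ?_
  split_ifs <;> simp [mul_comm]

/-- Summing rectangular partial sums of `a` against the weights `(m n) ^ (-(p + 1))` costs at most
a constant compared with summing `a` against the weights `(m n) ^ (-p)`. -/
theorem tsum_weighted_double_sum_le {p : ℝ} (hp : 1 ≤ p) (a : ℕ → ℕ → ℝ≥0∞) :
    ∑' (m : ℕ) (n : ℕ), (((m : ℝ≥0∞) + 1) ^ (p + 1))⁻¹ * (((n : ℝ≥0∞) + 1) ^ (p + 1))⁻¹ *
        ∑ i ∈ Finset.range (m + 1), ∑ j ∈ Finset.range (n + 1), a i j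
      ≤ 4 * ∑' (i : ℕ) (j : ℕ), a i j / (((i : ℝ≥0∞) + 1) ^ p * ((j : ℝ≥0∞) + 1) ^ p) := by
  set w : ℕ → ℝ≥0∞ := fun m => (((m : ℝ≥0∞) + 1) ^ (p + 1))⁻¹ with hw
  have h1 (m : ℕ) : ∑' n : ℕ, w m * w n *
      ∑ i ∈ Finset.range (m + 1), ∑ j ∈ Finset.range (n + 1), a i j
      = w m * ∑ i ∈ Finset.range (m + 1), ∑' j, a i j * ∑' n, if j ≤ n then w n else 0 := by
    simp only [mul_assoc]
    rw [ENNReal.tsum_mul_left]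
    simp only [Finset.mul_sum (Finset.range (m + 1))]
    rw [Summable.tsum_finsetSum fun _ _ => ENNReal.summable, Finset.mul_sum]
    simp only [ENNReal.tsum_mul_sum_range_succ]
  calc _ = ∑' m : ℕ, w m *
        ∑ i ∈ Finset.range (m + 1), ∑' j, a i j * ∑' n, if j ≤ n then w n else 0 :=
        tsum_congr h1
    _ = ∑' i, (∑' j, a i j * ∑' n, if j ≤ n then w n else 0) * ∑' m, if i ≤ m then w m else 0 :=
        ENNReal.tsum_mul_sum_range_succ _ _
    -- Each of the two tails costs a factor 2, hence the 4.
    _ ≤ ∑' i : ℕ, (∑' j : ℕ, a i j * (2 * (((j : ℝ≥0∞) + 1) ^ p)⁻¹)) *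
          (2 * (((i : ℝ≥0∞) + 1) ^ p)⁻¹) := by
        gcongr with i j
        · exact tsum_inv_rpow_tail_le hp j
        · exact tsum_inv_rpow_tail_le hp i
    _ = _ := by
        simp only [← ENNReal.tsum_mul_right, ← ENNReal.tsum_mul_left]
        refine tsum_congr fun i => tsum_congr fun j => ?_
        rw [ENNReal.div_eq_inv_mul, ENNReal.mul_inv (by simp) (by simp)]
        ring

end Tails

/-! ### Type `p` implies complete convergence -/

theorem enorm_inv_rpow_smul_rpow {X : Type u} [NormedAddCommGroup X] [NormedSpace ℝ X] {p : ℝ} (hp : 1 ≤ p) (m n : ℕ) (x : X) :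
    ‖((((m : ℝ) + 1) * ((n : ℝ) + 1)) ^ ((p + 1) / p))⁻¹ • x‖ₑ ^ p
      = (((m : ℝ≥0∞) + 1) ^ (p + 1))⁻¹ * (((n : ℝ≥0∞) + 1) ^ (p + 1))⁻¹ * ‖x‖ₑ ^ p := by
  have hp0 : 0 < p := by linarith
  rw [enorm_smul, ENNReal.mul_rpow_of_nonneg _ _ hp0.le,
    ← ofReal_inv_natCast_add_one_rpow (by linarith),
    ← ofReal_inv_natCast_add_one_rpow (by linarith), ← ENNReal.ofReal_mul (by positivity),
    enorm_rpow_eq_ofReal hp0.le]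
  congr 2
  rw [Real.norm_of_nonneg (by positivity), Real.inv_rpow (by positivity),
    ← Real.rpow_mul (by positivity), div_mul_cancel₀ _ hp0.ne',
    Real.mul_rpow (by positivity) (by positivity), mul_inv]

theorem doubleSum_eq_sum_product {X : Type u} [NormedAddCommGroup X] {Ω : Type v}
    (V : ℕ → ℕ → Ω → X) (m n : ℕ) (ω : Ω) :
    doubleSum V m n ω
      = ∑ k ∈ Finset.range (m + 1) ×ˢ Finset.range (n + 1), V k.1 k.2 ω := by
  rw [doubleSum, Finset.sum_product]

theorem IsRademacherType.convergesCompletelyInMean {p : ℝ} (hp : 1 ≤ p) {X : Type u}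
    [NormedAddCommGroup X] [NormedSpace ℝ X] [CompleteSpace X] [TopologicalSpace.SeparableSpace X]
    [MeasurableSpace X] [BorelSpace X] (h : IsRademacherType p X) {Ω : Type v} [MeasurableSpace Ω]
    {P : Measure Ω} [IsProbabilityMeasure P] {V : ℕ → ℕ → Ω → X} (hV : IsIndepMeanZeroArray V P)
    (hsum : ∑' (m : ℕ) (n : ℕ), (∫⁻ ω, ‖V m n ω‖ₑ ^ p ∂P) /
      (((m : ℝ≥0∞) + 1) ^ p * ((n : ℝ≥0∞) + 1) ^ p) < ∞) :
    ConvergesCompletelyInMean p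
      (fun m n ω => ((((m : ℝ) + 1) * ((n : ℝ) + 1)) ^ ((p + 1) / p))⁻¹ • doubleSum V m n ω) P := by
  have : SecondCountableTopology X := UniformSpace.secondCountable_of_separable X
  have hp0 : 0 ≤ p := by linarith
  -- Finite moments make the entries Bochner integrable, so that the Pettis mean is the Bochner
  -- integral.
  have hfin (m n : ℕ) : ∫⁻ ω, ‖V m n ω‖ₑ ^ p ∂P < ∞ := by
    have h1 := ENNReal.ne_top_of_tsum_ne_top (ENNReal.ne_top_of_tsum_ne_top hsum.ne m) n
    by_contra hcon
    rw [not_lt, top_le_iff] at hcon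
    rw [hcon, ENNReal.top_div_of_ne_top (by finiteness)] at h1
    exact h1 rfl
  have hi (m n : ℕ) : Integrable (V m n) P :=
    integrable_of_lintegral_enorm_rpow_lt_top hp (hV.measurable m n).aestronglyMeasurable (hfin m n)
  obtain ⟨K, hK, hKV⟩ := h.exists_lintegral_enorm_sum_rpow_le hp
  have hbound (m n : ℕ) : ∫⁻ ω, ‖doubleSum V m n ω‖ₑ ^ p ∂P ≤ K *
      ∑ i ∈ Finset.range (m + 1), ∑ j ∈ Finset.range (n + 1), ∫⁻ ω, ‖V i j ω‖ₑ ^ p ∂P := by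
    simp only [doubleSum_eq_sum_product]
    rw [← Finset.sum_product']
    exact hKV Ω P (ℕ × ℕ) (fun k => V k.1 k.2) (fun k => hV.measurable _ _) hV.indep
      (fun k => hi _ _) (fun k => (hV.mean_zero _ _).integral_eq (hi _ _)) _
  have hm := hV.measurable
  have hSm (m n : ℕ) : Measurable (doubleSum V m n) := by
    unfold doubleSum; fun_prop
  unfold ConvergesCompletelyInMean
  simp only [enorm_inv_rpow_smul_rpow hp]
  refine lt_of_le_of_lt ?_ (ENNReal.mul_lt_top hK.lt_top
    (ENNReal.mul_lt_top (ENNReal.ofNat_lt_top (n := 4)) hsum))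
  refine le_trans ?_ (mul_le_mul_right
    (tsum_weighted_double_sum_le hp fun m n => ∫⁻ ω, ‖V m n ω‖ₑ ^ p ∂P) K)
  simp only [← ENNReal.tsum_mul_left]
  refine ENNReal.tsum_le_tsum fun m => ENNReal.tsum_le_tsum fun n => ?_
  rw [lintegral_const_mul _ ((hSm m n).enorm.pow_const p), mul_left_comm]
  gcongr
  exact hbound m n

/-! ### Independent random signs -/

section Rademacher

instance Int.instMeasurableSingletonClassUnits : MeasurableSingletonClass ℤˣ where
  measurableSet_singleton u :=
    ⟨{(u : ℤ)}, MeasurableSet.singleton _, by ext v; simp [Units.ext_iff]⟩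

theorem exists_iIndepFun_rademacher (ι : Type) :
    ∃ (Ω : Type v) (_ : MeasurableSpace Ω) (P : Measure Ω) (ε : ι → Ω → ℤˣ),
      IsProbabilityMeasure P ∧ (∀ i, Measurable (ε i)) ∧ iIndepFun ε P ∧
        ∀ i u, P (ε i ⁻¹' {u}) = 2⁻¹ := by
  -- The lift places the sample space in universe `v`.
  set μ : Measure (ULift.{v} ℤˣ) :=
    (2⁻¹ : ℝ≥0∞) • (Measure.dirac (ULift.up 1) + Measure.dirac (ULift.up (-1))) with hμ
  have : IsProbabilityMeasure μ := ⟨by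
    simp only [hμ, Measure.smul_apply, Measure.add_apply, measure_univ, smul_eq_mul]
    rw [one_add_one_eq_two, ENNReal.inv_mul_cancel two_ne_zero ENNReal.ofNat_ne_top]⟩
  obtain ⟨Ω, mΩ, P, Y, hY, hlaw, hind, hP⟩ := exists_iid ι μ
  refine ⟨Ω, mΩ, P, fun i ω => (Y i ω).down, hP, fun i => measurable_down.comp (hY i),
    hind.comp (fun _ => ULift.down) fun _ => measurable_down, fun i u => ?_⟩
  have hs : MeasurableSet (ULift.down ⁻¹' {u} : Set (ULift.{v} ℤˣ)) :=
    measurable_down (MeasurableSet.singleton u)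
  have h := (hlaw i).map_eq
  have h2 : P.map (Y i) (ULift.down ⁻¹' {u}) = μ (ULift.down ⁻¹' {u}) := by rw [h]
  rw [Measure.map_apply (hY i) hs] at h2
  refine Eq.trans h2 ?_
  simp only [hμ, Measure.smul_apply, Measure.add_apply, smul_eq_mul, Measure.dirac_apply' _ hs]
  rcases Int.units_eq_one_or u with rfl | rfl <;> simp [Set.indicator]

variable {Ω : Type v} [MeasurableSpace Ω] {P : Measure Ω}

theorem integral_rademacher [IsProbabilityMeasure P] {ε : Ω → ℤˣ} (hε : Measurable ε) (h : ∀ u, P (ε ⁻¹' {u}) = 2⁻¹) :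
    ∫ ω, ((ε ω : ℤ) : ℝ) ∂P = 0 := by
  have hmap (u : ℤˣ) : (P.map ε).real {u} = 2⁻¹ := by
    rw [Measure.real, Measure.map_apply hε (MeasurableSet.singleton u), h]; simp
  have : IsProbabilityMeasure (P.map ε) := Measure.isProbabilityMeasure_map hε.aemeasurable
  have e := integral_map (μ := P) hε.aemeasurable (f := fun u : ℤˣ => ((u : ℤ) : ℝ))
    (measurable_of_finite _).aestronglyMeasurable
  rw [← e, integral_fintype Integrable.of_finite]
  simp [hmap]

theorem ProbabilityTheory.iIndepFun.lintegral_rademacher {n : ℕ} {ε : Fin n → Ω → ℤˣ}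
    (hε : ∀ i, Measurable (ε i)) (hind : iIndepFun ε P) (h : ∀ i u, P (ε i ⁻¹' {u}) = 2⁻¹)
    (F : (Fin n → ℤˣ) → ℝ≥0∞) :
    ∫⁻ ω, F (fun i => ε i ω) ∂P = (2 ^ n)⁻¹ * ∑ s, F s := by
  have hm : Measurable fun ω i => ε i ω := measurable_pi_lambda _ hε
  have hmap (s : Fin n → ℤˣ) : P.map (fun ω i => ε i ω) {s} = (2 ^ n)⁻¹ := by
    rw [Measure.map_apply hm (MeasurableSet.singleton s)]
    have hset : (fun ω i => ε i ω) ⁻¹' {s} = ⋂ i ∈ Finset.univ, ε i ⁻¹' {s i} := by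
      ext ω; simp [funext_iff]
    rw [hset, hind.measure_inter_preimage_eq_mul Finset.univ
      fun i _ => MeasurableSet.singleton (s i)]
    simp [h, ENNReal.inv_pow]
  rw [← lintegral_map (measurable_of_finite F) hm, lintegral_fintype, Finset.mul_sum]
  exact Finset.sum_congr rfl fun s _ => by rw [hmap, mul_comm]

end Rademacher

/-! ### Complete convergence implies type `p` -/

/-- Both sides of the type inequality are homogeneous of degree `p`, so a violating family can be
rescaled to any mass `T`. Its length `n` is fixed before `T`, which lets `T` depend on `n` later. -/
theorem exists_forall_scaled_of_not_isRademacherType {p : ℝ} (hp : 0 < p) {X : Type u}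
    [NormedAddCommGroup X] [NormedSpace ℝ X] (h : ¬ IsRademacherType p X) (C : ℕ) :
    ∃ n : ℕ, n ≠ 0 ∧ ∀ T : ℝ≥0∞, T ≠ ∞ → ∃ y : Fin n → X, ∑ i, ‖y i‖ₑ ^ p = T ∧
      C * T ≤ (2 ^ n)⁻¹ * ∑ ε : Fin n → ℤˣ, ‖∑ i, ((ε i : ℤ) : ℝ) • y i‖ₑ ^ p := by
  simp only [IsRademacherType, not_exists, not_forall, not_le] at h
  obtain ⟨n, x, hx⟩ := h C
  set s := ∑ i, ‖x i‖ ^ p with hs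
  have hs0 : 0 < s := by
    -- With zero mass all vectors vanish, and the strict violation would read `0 < 0`.
    refine (Finset.sum_nonneg fun i _ => by positivity).lt_of_ne fun h0 => ?_
    have hx0 : x = 0 := funext fun i => by
      have := (Finset.sum_eq_zero_iff_of_nonneg fun i _ => by positivity).1 h0.symm i
        (Finset.mem_univ i)
      simpa using (Real.rpow_eq_zero (norm_nonneg _) hp.ne').1 this
    rw [hs, ← h0] at hx
    simp [hx0, Real.zero_rpow hp.ne'] at hx
  refine ⟨n, ?_, fun T hT => ?_⟩
  · rintro rfl
    simp [hs] at hs0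
  set c := T.toReal / s with hc
  have hc0 : 0 ≤ c := by positivity
  have htp : (c ^ p⁻¹) ^ p = c := Real.rpow_inv_rpow hc0 hp.ne'
  have hscale (v : X) : ‖c ^ p⁻¹ • v‖ ^ p = c * ‖v‖ ^ p := by
    rw [norm_smul, Real.mul_rpow (norm_nonneg _) (norm_nonneg _),
      Real.norm_of_nonneg (by positivity), htp]
  refine ⟨fun i => c ^ p⁻¹ • x i, ?_, ?_⟩
  · simp only [enorm_rpow_eq_ofReal hp.le, hscale]
    rw [← ENNReal.ofReal_sum_of_nonneg fun _ _ => by positivity, ← Finset.mul_sum, ← hs, hc,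
      div_mul_cancel₀ _ hs0.ne', ENNReal.ofReal_toReal hT]
  · simp only [smul_comm _ (c ^ p⁻¹), ← Finset.smul_sum, enorm_rpow_eq_ofReal hp.le, hscale]
    rw [← ENNReal.ofReal_sum_of_nonneg fun _ _ => by positivity, ← Finset.mul_sum,
      show ((2 : ℝ≥0∞) ^ n)⁻¹ = ENNReal.ofReal ((2 ^ n)⁻¹) by
        rw [ENNReal.ofReal_inv_of_pos (by positivity), ENNReal.ofReal_pow two_pos.le]; simp,
      ← ENNReal.ofReal_mul (by positivity)]
    conv_lhs => rw [← ENNReal.ofReal_toReal hT, ← ENNReal.ofReal_natCast,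
      ← ENNReal.ofReal_mul (by positivity)]
    refine ENNReal.ofReal_le_ofReal ?_
    have h2 := mul_le_mul_of_nonneg_left hx.le hc0
    have h3 : c * (C * s) = C * T.toReal := by rw [hc]; field_simp
    rw [h3] at h2
    refine h2.trans_eq ?_
    ring

theorem isRademacherType_of_convergesCompletelyInMean {p : ℝ} (hp : 1 ≤ p) (X : Type u)
    [NormedAddCommGroup X] [NormedSpace ℝ X] [CompleteSpace X] [TopologicalSpace.SeparableSpace X]
    [MeasurableSpace X] [BorelSpace X]
    (H : ∀ (Ω : Type v) [MeasurableSpace Ω] (P : Measure Ω) [IsProbabilityMeasure P]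
      (V : ℕ → ℕ → Ω → X), IsIndepMeanZeroArray V P →
      ∑' (m : ℕ) (n : ℕ), (∫⁻ ω, ‖V m n ω‖ₑ ^ p ∂P) /
        (((m : ℝ≥0∞) + 1) ^ p * ((n : ℝ≥0∞) + 1) ^ p) < ∞ →
      ConvergesCompletelyInMean p
        (fun m n ω => ((((m : ℝ) + 1) * ((n : ℝ) + 1)) ^ ((p + 1) / p))⁻¹ • doubleSum V m n ω)
        P) :
    IsRademacherType p X := by
  have : SecondCountableTopology X := UniformSpace.secondCountable_of_separable X
  have hp0 : 0 < p := by linarith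
  by_contra hX
  choose n hn0 hn using fun k : ℕ => exists_forall_scaled_of_not_isRademacherType hp0 hX (4 ^ k)
  set a : ℕ → ℝ≥0∞ := fun k => ((k : ℝ≥0∞) + 1) ^ p with ha
  set b : ℕ → ℝ≥0∞ := fun k => (n k : ℝ≥0∞) ^ p with hb
  have ha0 (k : ℕ) : a k ≠ 0 := by simp [ha]
  have hat (k : ℕ) : a k ≠ ∞ := by simp [ha]
  have hb0 (k : ℕ) : b k ≠ 0 := by simp [hb, hp0, hn0]
  have hbt (k : ℕ) : b k ≠ ∞ := by simp [hb, hp0.le]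
  -- The mass cancels the weight `a k * b k` of row `k` and columns near `n k`, leaving the summable
  -- `2 ^ (-k)`; against it the constant `4 ^ k` still leaves `2 ^ k`.
  choose y hyT hyC using fun k => hn k (a k * b k * (2⁻¹) ^ k)
    (ENNReal.mul_ne_top (ENNReal.mul_ne_top (hat k) (hbt k)) (by finiteness))
  -- Row `k` carries the `k`-th family of vectors, in the columns from `n k` to `2 * n k - 1`.
  let col (k : ℕ) : Fin (n k) ↪ ℕ :=
    ⟨fun i => n k + i, fun i j hij => Fin.ext (by simpa using hij)⟩
  set z : ℕ → ℕ → X := fun k => Function.extend (col k) (y k) 0 with hz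
  have hzcol (k : ℕ) (i : Fin (n k)) : z k (col k i) = y k i :=
    (col k).injective.extend_apply _ _ _
  have hzsupp (k j : ℕ) (hj : j ∉ Finset.univ.map (col k)) : z k j = 0 :=
    Function.extend_apply' _ _ _ fun ⟨i, hi⟩ => hj (by simp [← hi])
  obtain ⟨Ω, mΩ, P, ε, hP, hεm, hεind, hεlaw⟩ := exists_iIndepFun_rademacher.{v} (ℕ × ℕ)
  set V : ℕ → ℕ → Ω → X := fun k j ω => ((ε (k, j) ω : ℤ) : ℝ) • z k j with hV
  have hφ (x : X) : Measurable fun u : ℤˣ => ((u : ℤ) : ℝ) • x := measurable_of_finite _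
  have hVm (k j : ℕ) : Measurable (V k j) := (hφ (z k j)).comp (hεm (k, j))
  have hVind : iIndepFun (fun k : ℕ × ℕ => V k.1 k.2) P :=
    hεind.comp (fun k u => ((u : ℤ) : ℝ) • z k.1 k.2) fun k => hφ _
  have hεi (k : ℕ × ℕ) : Integrable (fun ω => ((ε k ω : ℤ) : ℝ)) P := by
    refine Integrable.of_bound ((measurable_of_finite fun u : ℤˣ => ((u : ℤ) : ℝ)).comp
      (hεm k)).aestronglyMeasurable 1 (Filter.Eventually.of_forall fun ω => ?_)
    rcases Int.units_eq_one_or (ε k ω) with h | h <;> simp [h]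
  have hVi (k j : ℕ) : Integrable (V k j) P := (hεi (k, j)).smul_const _
  have hV0 (k j : ℕ) : ∫ ω, V k j ω ∂P = 0 := by
    simp only [hV]
    rw [integral_smul_const, integral_rademacher (hεm _) (hεlaw _), zero_smul]
  have hVarr : IsIndepMeanZeroArray V P := ⟨hVm, hVind, fun k j f =>
    ⟨f.integrable_comp (hVi k j), by rw [f.integral_comp_comm (hVi k j), hV0, map_zero]⟩⟩
  have hVnorm (k j : ℕ) : ∫⁻ ω, ‖V k j ω‖ₑ ^ p ∂P = ‖z k j‖ₑ ^ p := by
    have (ω : Ω) : ‖V k j ω‖ₑ = ‖z k j‖ₑ := by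
      rcases Int.units_eq_one_or (ε (k, j) ω) with h | h <;> simp [hV, h]
    simp [this]
  have hrow (k : ℕ) : ∑' j : ℕ, (∫⁻ ω, ‖V k j ω‖ₑ ^ p ∂P) /
      (((k : ℝ≥0∞) + 1) ^ p * ((j : ℝ≥0∞) + 1) ^ p) ≤ (2⁻¹) ^ k := by
    simp only [hVnorm]
    rw [tsum_eq_sum (s := Finset.univ.map (col k)) fun j hj => by
      rw [hzsupp k j hj]; simp [hp0], Finset.sum_map]
    calc _ ≤ ∑ i, ‖y k i‖ₑ ^ p / (a k * b k) := by
          refine Finset.sum_le_sum fun i _ => ?_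
          rw [hzcol]
          -- The block lies to the right of column `n k`, so every denominator is at least `a k * b
          -- k`.
          refine ENNReal.div_le_div_left (mul_le_mul_right (ENNReal.rpow_le_rpow ?_ hp0.le) _) _
          exact_mod_cast (by omega : n k ≤ n k + i + 1)
      _ = (a k * b k * (2⁻¹) ^ k) / (a k * b k) := by
          simp only [div_eq_mul_inv]
          rw [← Finset.sum_mul, hyT]
      _ = (2⁻¹) ^ k := by
          rw [mul_comm, ENNReal.mul_div_cancel_right (mul_ne_zero (ha0 k) (hb0 k))
            (ENNReal.mul_ne_top (hat k) (hbt k))]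
  have hconv := H Ω P V hVarr <| (ENNReal.tsum_le_tsum hrow).trans_lt (by
    rw [ENNReal.tsum_geometric]
    simp)
  -- These rectangles contain the whole block of row `k`; the other entries cannot lower the moment,
  -- and the block's own moment is exactly the average over signs.
  have hblock (k m l : ℕ) (hm : k ≤ m) (hl : 2 * n k ≤ l) :
      (4 ^ k : ℕ) * (a k * b k * (2⁻¹) ^ k) ≤ ∫⁻ ω, ‖doubleSum V m l ω‖ₑ ^ p ∂P := by
    let e : Fin (n k) ↪ ℕ × ℕ :=
      ⟨fun i => (k, col k i), fun i j hij => (col k).injective (Prod.ext_iff.1 hij).2⟩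
    have hsub : Finset.univ.map e ⊆ Finset.range (m + 1) ×ˢ Finset.range (l + 1) := by
      intro q hq
      obtain ⟨i, -, rfl⟩ := Finset.mem_map.1 hq
      simp only [Finset.mem_product, Finset.mem_range]
      have := i.2
      exact ⟨Nat.lt_succ_of_le hm, show n k + (i : ℕ) < l + 1 by omega⟩
    have hmono := hVind.lintegral_enorm_sum_rpow_mono hp (fun k => hVm _ _) (fun k => hVi _ _)
      (fun k => hV0 _ _) hsub
    simp only [← doubleSum_eq_sum_product] at hmono
    refine (hyC k).trans (le_trans (le_of_eq ?_) hmono)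
    rw [← (hεind.precomp e.injective).lintegral_rademacher (fun i => hεm _) (fun i => hεlaw _)
      fun s => ‖∑ i, ((s i : ℤ) : ℝ) • y k i‖ₑ ^ p]
    refine lintegral_congr fun ω => ?_
    rw [Finset.sum_map]
    congr 2
    refine Finset.sum_congr rfl fun i _ => ?_
    rw [← hzcol]
    rfl
  set w : ℕ → ℝ≥0∞ := fun m => (((m : ℝ≥0∞) + 1) ^ (p + 1))⁻¹ with hw
  set d : ℝ≥0∞ := ((2 : ℝ≥0∞) ^ (p + 1))⁻¹ with hd
  have hSm (m n : ℕ) : Measurable (doubleSum V m n) := by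
    unfold doubleSum; fun_prop
  unfold ConvergesCompletelyInMean at hconv
  simp only [enorm_inv_rpow_smul_rpow hp] at hconv
  have hlower (k : ℕ) : d * d * ((3 : ℝ≥0∞) ^ p)⁻¹ * 2 ^ k ≤
      ∑' (m : ℕ) (l : ℕ), ∫⁻ ω, w m * w l * ‖doubleSum V m l ω‖ₑ ^ p ∂P := by
    set B : ℝ≥0∞ := (4 ^ k : ℕ) * (a k * b k * (2⁻¹) ^ k) with hB
    -- Since `n k ≥ 1`, `2 * n k + 1 ≤ 3 * n k`.
    have h3 : (3 ^ p)⁻¹ * (b k)⁻¹ ≤ ((((2 * n k : ℕ) : ℝ≥0∞) + 1) ^ p)⁻¹ := by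
      rw [← ENNReal.mul_inv (by simp) (by simp), hb, ← ENNReal.mul_rpow_of_nonneg _ _ hp0.le]
      refine ENNReal.inv_le_inv.2 (ENNReal.rpow_le_rpow ?_ hp0.le)
      have := Nat.pos_of_ne_zero (hn0 k)
      exact_mod_cast (by omega : 2 * n k + 1 ≤ 3 * n k)
    calc d * d * (3 ^ p)⁻¹ * 2 ^ k
        = (d * (a k)⁻¹) * (d * ((3 ^ p)⁻¹ * (b k)⁻¹)) * B := by
          have h4 : ((4 ^ k : ℕ) : ℝ≥0∞) * (2⁻¹) ^ k = 2 ^ k := by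
            push_cast
            rw [← mul_pow, show (4 : ℝ≥0∞) = 2 * 2 by norm_num, mul_assoc,
              ENNReal.mul_inv_cancel two_ne_zero ENNReal.ofNat_ne_top, mul_one]
          calc _ = d * d * (3 ^ p)⁻¹ * (((4 ^ k : ℕ) : ℝ≥0∞) * (2⁻¹) ^ k) *
                (a k * (a k)⁻¹) * (b k * (b k)⁻¹) := by
                rw [h4, ENNReal.mul_inv_cancel (ha0 k) (hat k),
                  ENNReal.mul_inv_cancel (hb0 k) (hbt k), mul_one, mul_one]
            _ = _ := by rw [hB]; ring
      _ ≤ (∑' m, if k ≤ m then w m else 0) * (∑' l, if 2 * n k ≤ l then w l else 0) * B :=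
          mul_le_mul_left (mul_le_mul' (le_tsum_inv_rpow_tail hp0.le k)
            ((mul_le_mul_right h3 d).trans (le_tsum_inv_rpow_tail hp0.le (2 * n k)))) B
      _ = ∑' (m : ℕ) (l : ℕ),
            (if k ≤ m then w m else 0) * (if 2 * n k ≤ l then w l else 0) * B := by
          rw [← ENNReal.tsum_mul_right, ← ENNReal.tsum_mul_right]
          simp only [ENNReal.tsum_mul_left, ENNReal.tsum_mul_right]
      _ ≤ _ := by
          refine ENNReal.tsum_le_tsum fun m => ENNReal.tsum_le_tsum fun l => ?_
          rw [lintegral_const_mul _ ((hSm m l).enorm.pow_const p)]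
          split_ifs with hm hl
          · gcongr
            exact hblock k m l hm hl
          all_goals simp
  have hc0 : d * d * ((3 : ℝ≥0∞) ^ p)⁻¹ ≠ 0 := by
    have : d ≠ 0 := by simp [hd]
    refine mul_ne_zero (mul_ne_zero this this) ?_
    simp
  -- The constant does not depend on `k`, so `2 ^ N ≥ N` exceeds any finite value of the series.
  obtain ⟨N, hN⟩ := ENNReal.exists_nat_mul_gt hc0 hconv.ne
  refine absurd (hN.trans_le ?_) (lt_irrefl _)
  refine le_trans ?_ (hlower N)
  rw [mul_comm]
  gcongr
  exact_mod_cast Nat.lt_two_pow_self.le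

theorem theorem3p1 (p : ℝ) (hp1 : 1 ≤ p) (hp2 : p ≤ 2)
    (X : Type u) [NormedAddCommGroup X] [NormedSpace ℝ X] [CompleteSpace X]
    [TopologicalSpace.SeparableSpace X] [MeasurableSpace X] [BorelSpace X] :
    IsRademacherType p X ↔
      ∀ (Ω : Type v) [MeasurableSpace Ω] (P : Measure Ω) [IsProbabilityMeasure P]
        (V : ℕ → ℕ → Ω → X), IsIndepMeanZeroArray V P →
        ∑' (m : ℕ) (n : ℕ), (∫⁻ ω, ‖V m n ω‖ₑ ^ p ∂P) /
          (((m : ℝ≥0∞) + 1) ^ p * ((n : ℝ≥0∞) + 1) ^ p) < ∞ →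
        ConvergesCompletelyInMean p
          (fun m n ω => ((((m : ℝ) + 1) * ((n : ℝ) + 1)) ^ ((p + 1) / p))⁻¹ • doubleSum V m n ω)
          P := by
  exact ⟨fun h Ω _ P _ V hV hsum => h.convergesCompletelyInMean hp1 hV hsum,
    fun H => isRademacherType_of_convergesCompletelyInMean hp1 X H⟩
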